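/- Let $G$ be a finite group and let $H\le G$ be a nonnormal T.I. subgroup, i.e. $H$ is not normal in $G$ and for every $x\in G$ the intersection $H\cap H^x$ is either $H$ or trivial. Let $\pi$ be the set of primes dividing $|H|$, and assume that $G$ is $\pi$-separable, i.e. $G$ has a series $1=G_0\le G_1\le\dots\le G_n=G$ of normal subgroups of $G$ such that each factor $G_{i+1}/G_i$ is a $\pi$-group or a $\pi'$-group. Assume that $H$ is a Hall subgroup of its normalizer $N_G(H)$, i.e. $\gcd(|H|,|N_G(H):H|)=1$. Assume further that a Sylow $2$-subgroup of $H$ is abelian, and let $Q$ be a complement of $H$ in $N_G(H)$, i.e. $Q\le N_G(H)$, $HQ=N_G(H)$ and $H\cap Q=1$. Then $C_H(Q)$, the centralizer of $Q$ in $H$, is a Hall subgroup of $G$ (its order is coprime to its index in $G$) and it has a normal complement in $G$: there is a normal subgroup $N$ of $G$ with $N\,C_H(Q)=G$ and $N\cap C_H(Q)=1$. -/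

import Mathlib

/-- `H` is a T.I. subgroup of `G`: for every `x`, the intersection of `H` with its conjugate
`x H x⁻¹` is `H` or trivial. -/
def Subgroup.IsTI {G : Type*} [Group G] (H : Subgroup G) : Prop :=
  ∀ x : G, H ⊓ H.map (MulAut.conj x).toMonoidHom = H ∨
    H ⊓ H.map (MulAut.conj x).toMonoidHom = ⊥

/-- `H` is a Hall subgroup of the finite group `G`: its order is coprime to its index. -/
def Subgroup.IsHall {G : Type*} [Group G] (H : Subgroup G) : Prop :=
  (Nat.card H).Coprime H.index

/-- `n` is a `π`-number: each of its prime divisors lies in `π`. -/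
def IsPiNumber (π : Set ℕ) (n : ℕ) : Prop :=
  ∀ p : ℕ, p.Prime → p ∣ n → p ∈ π

/-- The finite group `G` is `π`-separable: it has a series
`1 = s 0 ≤ s 1 ≤ ⋯ ≤ s n = G` of normal subgroups of `G` such that each factor
`s (i + 1) / s i` is a `π`-group or a `π'`-group. The order of that factor is
`(s i).relIndex (s (i + 1))`, and `π'` is the set of primes outside `π`. -/
def IsPiSeparable (π : Set ℕ) (G : Type*) [Group G] : Prop :=
  ∃ (n : ℕ) (s : ℕ → Subgroup G), s 0 = ⊥ ∧ s n = ⊤ ∧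
    (∀ i ≤ n, (s i).Normal) ∧
    ∀ i < n, s i ≤ s (i + 1) ∧
      (IsPiNumber π ((s i).relIndex (s (i + 1))) ∨
        IsPiNumber πᶜ ((s i).relIndex (s (i + 1))))

/-! The T.I. condition puts normalizers of nontrivial subgroups of `H` inside `N_G(H)`, so the Hall
property of `H` passes from `N_G(H)` to `G` (`Subgroup.IsTI.isHall`). With `π`-separability, a
Frattini argument then gives a normal subgroup `M` of order prime to `|H|` with `N_G(H) M = G`
(`Subgroup.IsTI.exists_normal_sup_normalizer_eq_top`).

Any nontrivial element of `H` has the same centralizer in `M` as all of `H`. If `H` contained a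
noncyclic group of order `p ^ 2`, the fixed points of its nontrivial elements would force `M` to
centralize `H`, and `H` would be normal in `G`. So the Sylow subgroups of `H` are cyclic, the
abelian hypothesis being what `p = 2` requires (`Subgroup.IsTI.isZGroup`).

Modulo `M` the group becomes the image of `N_G(H) = H Q`, with `H` a normal Z-group and `Q` of
coprime order. Here `H'` and `H / H'` are cyclic of coprime orders. The fixed points of `Q` on each
form a Hall subgroup, transfer yields a normal subgroup avoiding each, and the intersection of the
two is the complement (`Subgroup.exists_normal_complement_inf_centralizer`). As `H ∩ M = 1`, fixed
points lift from `G / M`, and the preimage of the complement is the required subgroup. -/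

/-! ### `p`-groups of rank one. -/

theorem mul_pow_of_commute_commutator {P : Type*} [Group P] {x y c : P} (h : y * x = c * x * y)
    (hcx : Commute c x) (hcy : Commute c y) (n : ℕ) :
    y ^ n * x = c ^ n * x * y ^ n ∧ (x * y) ^ n = c ^ n.choose 2 * x ^ n * y ^ n := by
  induction n with
  | zero => simp
  | succ n ih =>
    obtain ⟨ih1, ih2⟩ := ih
    constructor
    · rw [pow_succ', mul_assoc, ih1, ← mul_assoc, ← mul_assoc, ← (hcy.pow_left n).eq,
        mul_assoc (c ^ n), h, pow_succ c]
      simp only [mul_assoc]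
    · have h1 : (n + 1).choose 2 = n.choose 2 + n := by
        rw [Nat.choose_succ_succ' n 1, Nat.choose_one_right, add_comm]
      rw [pow_succ, ih2, mul_assoc, ← mul_assoc (y ^ n), ih1, h1, pow_add, pow_succ x, pow_succ y]
      simp only [mul_assoc]
      rw [← mul_assoc (x ^ n) (c ^ n), ← (hcx.pow_pow n n).eq]
      simp only [mul_assoc]

theorem IsPGroup.index_of_isCoatom {p : ℕ} [hp : Fact p.Prime] {P : Type*} [Group P] [Finite P]
    (hP : IsPGroup p P) {M : Subgroup P} (hM : IsCoatom M) : M.index = p := by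
  obtain ⟨n, hn⟩ := IsPGroup.iff_card.1 (hP.to_subgroup M)
  obtain ⟨k, hk⟩ := hP.index M
  have hk0 : k ≠ 0 := by
    rintro rfl
    exact hM.1 (Subgroup.index_eq_one.1 (by simpa using hk))
  have hc := M.card_mul_index
  rw [hn, hk] at hc
  have hdvd : p ^ (n + 1) ∣ Nat.card P := by
    rw [← hc, pow_succ]
    exact mul_dvd_mul_left _ (dvd_pow_self p hk0)
  obtain ⟨K, hK, hMK⟩ := Sylow.exists_subgroup_card_pow_succ hdvd hn
  have hlt : M < K := by
    refine lt_of_le_of_ne hMK ?_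
    rintro rfl
    rw [hn] at hK
    exact absurd (Nat.pow_right_injective hp.out.two_le hK) (by simp)
  have hT := hM.2 K hlt
  rw [hT, Subgroup.card_top, ← hc, pow_succ] at hK
  rw [hk]
  exact Nat.eq_of_mul_eq_mul_left (pow_pos hp.out.pos n) hK

theorem IsPGroup.normal_of_isCoatom {p : ℕ} [Fact p.Prime] {P : Type*} [Group P] [Finite P]
    (hP : IsPGroup p P) {M : Subgroup P} (hM : IsCoatom M) : M.Normal := by
  have := hP.isNilpotent
  have key : Group.IsNilpotent P ↔ ∀ H : Subgroup P, IsCoatom H → H.Normal :=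
    (Group.isNilpotent_of_finite_tfae (G := P)).out 0 2
  exact key.1 this M hM

theorem IsPGroup.commutator_mem_of_isCoatom {p : ℕ} [hp : Fact p.Prime] {P : Type*} [Group P]
    [Finite P] (hP : IsPGroup p P) {M : Subgroup P} (hM : IsCoatom M) (x y : P) :
    x * y * x⁻¹ * y⁻¹ ∈ M := by
  have hN := hP.normal_of_isCoatom hM
  have hc : Nat.card (P ⧸ M) = p := hP.index_of_isCoatom hM
  have : IsCyclic (P ⧸ M) := isCyclic_of_prime_card hc
  let _ := IsCyclic.commGroup (α := P ⧸ M)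
  rw [← QuotientGroup.eq_one_iff]
  change ((x : P ⧸ M) * y * (x : P ⧸ M)⁻¹ * (y : P ⧸ M)⁻¹) = 1
  rw [mul_comm (x : P ⧸ M) y, mul_inv_cancel_right, mul_inv_cancel]

/-- Since `y ^ p` is central, the commutator `c` of `y` and `x` satisfies `c ^ p = 1`; for odd `p`
the exponent `p.choose 2` of `c` is a multiple of `p`. -/
theorem IsPGroup.pow_mul_of_mem_center {p : ℕ} [hp : Fact p.Prime] {P : Type*} [Group P]
    (hodd : p ≠ 2 ∨ ∀ a b : P, a * b = b * a)
    (hc : ∀ x y : P, x * y * x⁻¹ * y⁻¹ ∈ Subgroup.center P)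
    (hz : ∀ x : P, x ^ p ∈ Subgroup.center P) (x y : P) : (x * y) ^ p = x ^ p * y ^ p := by
  rcases hodd with hodd | hcomm
  · set c := y * x * y⁻¹ * x⁻¹ with hcdef
    have hcc := Subgroup.mem_center_iff.1 (hc y x)
    have key := mul_pow_of_commute_commutator (x := x) (y := y) (c := c) (by simp [hcdef])
      (hcc x).symm (hcc y).symm p
    have h1 : c ^ p = 1 := by
      have h2 := Subgroup.mem_center_iff.1 (hz y) x
      rw [← h2, mul_assoc] at key
      exact right_eq_mul.1 key.1
    obtain ⟨k, hk⟩ := hp.out.dvd_choose_self (k := 2) (by norm_num)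
      (lt_of_le_of_ne hp.out.two_le (Ne.symm hodd))
    rw [key.2, hk, pow_mul, h1, one_pow, one_mul]
  · exact (show Commute x y from hcomm x y).mul_pow p

/-- A finite `p`-group without elementary abelian subgroups of rank two is cyclic, provided that
`p` is odd or the group is commutative. -/
theorem IsPGroup.isCyclic_of_forall_mem_zpowers {p : ℕ} [hp : Fact p.Prime] {P : Type*} [Group P]
    [Finite P] (hP : IsPGroup p P) (hodd : p ≠ 2 ∨ ∀ a b : P, a * b = b * a)
    (h : ∀ a b : P, orderOf a = p → orderOf b = p → Commute a b → a ∈ Subgroup.zpowers b) :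
    IsCyclic P := by
  induction hn : Nat.card P using Nat.strong_induction_on generalizing P with
  | _ n ih =>
  subst hn
  by_contra hnc
  have hsub : ∀ M : Subgroup P, M ≠ ⊤ → IsCyclic M := by
    intro M hM
    refine ih _ ?_ (hP.to_subgroup M) ?_ ?_ rfl
    · exact lt_of_le_of_ne M.card_le_card_group (fun h => hM (Subgroup.eq_top_of_card_eq M h))
    · exact hodd.imp_right fun h a b => Subtype.ext (h a b)
    · intro a b ha hb hab
      obtain ⟨k, hk⟩ := h a b (by simpa using ha) (by simpa using hb)
        (by simpa using hab.map M.subtype)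
      exact ⟨k, Subtype.ext (by simpa using hk)⟩
  have hnt : Nontrivial P := by
    by_contra hnt
    rw [not_nontrivial_iff_subsingleton] at hnt
    exact hnc inferInstance
  obtain ⟨M₁, hM₁, -⟩ := (eq_top_or_exists_le_coatom (⊥ : Subgroup P)).resolve_left bot_ne_top
  obtain ⟨x, hx⟩ : ∃ x, x ∉ M₁ := by
    by_contra hall
    push Not at hall
    exact hM₁.1 (eq_top_iff.2 fun x _ => hall x)
  have hxt : Subgroup.zpowers x ≠ ⊤ := fun ht =>
    hnc ⟨x, fun y => Subgroup.mem_zpowers_iff.1 (ht ▸ Subgroup.mem_top y)⟩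
  obtain ⟨M₂, hM₂, hx₂⟩ := (eq_top_or_exists_le_coatom (Subgroup.zpowers x)).resolve_left hxt
  have hne : M₁ ≠ M₂ := by
    rintro rfl
    exact hx (hx₂ (Subgroup.mem_zpowers x))
  have hsup : M₁ ⊔ M₂ = ⊤ := hM₁.sup_eq_top_of_ne hM₂ hne
  -- By induction both maximal subgroups are cyclic, so their intersection commutes with each of
  -- them, hence with the group they generate.
  have hcen : M₁ ⊓ M₂ ≤ Subgroup.center P := by
    have aux : ∀ M : Subgroup P, M ≠ ⊤ → ∀ z ∈ M, M ≤ Subgroup.centralizer {z} := by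
      intro M hM z hz y hy
      have := hsub M hM
      let _ := IsCyclic.commGroup (α := M)
      rw [Subgroup.mem_centralizer_singleton_iff]
      exact congrArg Subtype.val (mul_comm (⟨y, hy⟩ : M) ⟨z, hz⟩)
    rintro z ⟨hz₁, hz₂⟩
    have : (⊤ : Subgroup P) ≤ Subgroup.centralizer {z} :=
      hsup ▸ sup_le (aux M₁ hM₁.1 z hz₁) (aux M₂ hM₂.1 z hz₂)
    rw [Subgroup.mem_center_iff]
    intro g
    exact Subgroup.mem_centralizer_singleton_iff.1 (this (Subgroup.mem_top g))
  have hpow : ∀ y : P, y ^ p ∈ M₁ ⊓ M₂ := by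
    intro y
    have h1 := hP.normal_of_isCoatom hM₁
    have h2 := hP.normal_of_isCoatom hM₂
    exact ⟨hP.index_of_isCoatom hM₁ ▸ M₁.pow_index_mem y,
      hP.index_of_isCoatom hM₂ ▸ M₂.pow_index_mem y⟩
  let f : P →* P :=
    { toFun := fun y => y ^ p
      map_one' := one_pow p
      map_mul' := IsPGroup.pow_mul_of_mem_center hodd
        (fun y z => hcen ⟨hP.commutator_mem_of_isCoatom hM₁ y z,
          hP.commutator_mem_of_isCoatom hM₂ y z⟩) (fun y => hcen (hpow y)) }
  have hrange : f.range ≤ M₁ ⊓ M₂ := by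
    rintro _ ⟨y, rfl⟩
    exact hpow y
  obtain ⟨b, hb⟩ : ∃ b : Subgroup.center P, orderOf b = p := by
    have := hP.center_nontrivial
    exact exists_prime_orderOf_dvd_card' p
      (((hP.to_subgroup _).card_eq_or_dvd).resolve_left (Finite.one_lt_card.ne'))
  have hb' : orderOf (b : P) = p := by rw [← hb, Subgroup.orderOf_coe]
  have hker : f.ker ≤ Subgroup.zpowers (b : P) := by
    intro a ha
    by_cases ha1 : a = 1
    · rw [ha1]; exact one_mem _
    · exact h a b (orderOf_eq_prime ha ha1) hb' (Subgroup.mem_center_iff.1 b.2 a)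
  -- The kernel of the `p`-th power map lies in a central subgroup of order `p`, so the range is too
  -- large to sit properly in a maximal subgroup. It would then equal both `M₁` and `M₂`.
  have hidx : f.range.index ≤ p := by
    rw [Subgroup.index_range, ← hb', ← Nat.card_zpowers]
    exact Subgroup.card_le_of_le hker
  have heq : ∀ M : Subgroup P, IsCoatom M → f.range ≤ M → f.range = M := by
    intro M hM hle
    by_contra hne
    have := Subgroup.index_strictAnti (lt_of_le_of_ne hle hne)
    rw [hP.index_of_isCoatom hM] at this
    omega
  exact hne ((heq M₁ hM₁ (hrange.trans inf_le_left)).symm.trans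
    (heq M₂ hM₂ (hrange.trans inf_le_right)))

/-! ### Coprime action of a noncyclic group of order `p ^ 2`. -/

theorem Monoid.End.apply_prod_range_pow {V : Type*} [CommGroup V] {p : ℕ} {γ : Monoid.End V}
    (hγ : γ ^ p = 1) (x : V) :
    γ (∏ j ∈ Finset.range p, (γ ^ j) x) = ∏ j ∈ Finset.range p, (γ ^ j) x := by
  have h := (Finset.prod_range_succ' (fun j => (γ ^ j) x) p).symm.trans
    (Finset.prod_range_succ (fun j => (γ ^ j) x) p)
  simp only [hγ, pow_zero] at h
  rw [map_prod, ← mul_right_cancel h]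
  exact Finset.prod_congr rfl fun j _ => by rw [pow_succ']; rfl

/-- The product of all `((α * β ^ i) ^ j) x` is computed in two ways. For fixed `i` the factors
multiply to a fixed point of `α * β ^ i`, hence to `1`. For fixed `j ≠ 0` they multiply to the image
under `α ^ j` of a fixed point of `β ^ j`, again `1`, while `j = 0` contributes `x ^ p`. -/
theorem Monoid.End.pow_eq_one_of_fixedPoints_trivial {V : Type*} [CommGroup V] {p : ℕ}
    (hp : 0 < p) {α β : Monoid.End V} (hc : Commute α β) (hα : α ^ p = 1) (hβ : β ^ p = 1)
    (hfβ : ∀ j, 0 < j → j < p → ∀ v, (β ^ j) v = v → v = 1)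
    (hf : ∀ i < p, ∀ v, (α * β ^ i) v = v → v = 1) (x : V) : x ^ p = 1 := by
  have hprod : ∏ i ∈ Finset.range p, ∏ j ∈ Finset.range p, ((α * β ^ i) ^ j) x = 1 := by
    refine Finset.prod_eq_one fun i hi => hf i (Finset.mem_range.1 hi) _ ?_
    refine Monoid.End.apply_prod_range_pow ?_ x
    rw [(hc.pow_right i).mul_pow, hα, ← pow_mul, mul_comm i, pow_mul, hβ, one_pow, one_mul]
  rw [Finset.prod_comm, Finset.prod_eq_single_of_mem 0 (Finset.mem_range.2 hp)] at hprod
  · simpa using hprod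
  · intro j hj hj0
    have h1 : ∀ i, ((α * β ^ i) ^ j) x = (α ^ j) (((β ^ j) ^ i) x) := by
      intro i
      rw [(hc.pow_right i).mul_pow, ← pow_mul, mul_comm i, pow_mul]
      rfl
    simp only [h1]
    rw [← map_prod, hfβ j (Nat.pos_of_ne_zero hj0) (Finset.mem_range.1 hj) _
      (Monoid.End.apply_prod_range_pow (by rw [← pow_mul, mul_comm, pow_mul, hβ, one_pow]) x),
      map_one]

/-- Conjugating `k` times by `g` multiplies `t` by `f ^ k`, so `k = p` gives `f ^ p = 1`. This lifts
fixed points from a quotient by a subgroup that `g` centralizes. -/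
theorem commute_of_conj_eq_mul {G : Type*} [Group G] {g t f : G} {p : ℕ} (hgp : g ^ p = 1)
    (hgf : Commute g f) (h : g * t * g⁻¹ = t * f) (hf : p.Coprime (orderOf f)) : Commute g t := by
  have key : ∀ k : ℕ, g ^ k * t = t * f ^ k * g ^ k := by
    intro k
    induction k with
    | zero => simp
    | succ k ih =>
      rw [pow_succ', mul_assoc, ih, ← mul_assoc, ← mul_assoc, mul_inv_eq_iff_eq_mul.1 h,
        mul_assoc (t * f), (hgf.pow_right k).eq, pow_succ' f]
      simp only [mul_assoc]
  have h1 := key p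
  rw [hgp, one_mul, mul_one] at h1
  have h2 : f = 1 := by
    rw [← orderOf_eq_one_iff]
    exact Nat.eq_one_of_dvd_coprimes hf (orderOf_dvd_of_pow_eq_one (left_eq_mul.1 h1)) dvd_rfl
  rw [h2, mul_one, mul_inv_eq_iff_eq_mul] at h
  exact h

theorem Subgroup.commutator_self_lt_of_isSolvable {G : Type*} [Group G] {T : Subgroup G}
    [Group.IsSolvable T] (hT : T ≠ ⊥) : ⁅T, T⁆ < T := by
  have hnt : Nontrivial T := T.nontrivial_iff_ne_bot.2 hT
  refine lt_of_le_of_ne (commutator_le_self T) fun h => ?_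
  have h1 : _root_.commutator T < ⊤ := Group.IsSolvable.commutator_lt_top_of_nontrivial T
  refine h1.ne (map_injective T.subtype_injective ?_)
  rw [map_subtype_commutator, h, ← MonoidHom.range_eq_map, range_subtype]

/-- By induction `F` contains the derived subgroup of `T`, so `T / (F ∩ T)` is an abelian group on
which `a` and `b` act. Fixed points lift and are therefore trivial, which kills all `p`-th powers;
as `p` is prime to `|T|`, so is the quotient. -/
theorem Subgroup.le_of_forall_commute_mem {G : Type*} [Group G] {p : ℕ} (hp : p.Prime) {a b : G}
    (hab : Commute a b) (hap : a ^ p = 1) (hbp : b ^ p = 1) {F : Subgroup G}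
    (hFa : ∀ f ∈ F, Commute a f) (hFb : ∀ f ∈ F, Commute b f) {T : Subgroup G} [Finite T]
    [Group.IsSolvable T] (hpT : p.Coprime (Nat.card T)) (haT : a ∈ normalizer (T : Set G))
    (hbT : b ∈ normalizer (T : Set G))
    (hb : ∀ j, 0 < j → j < p → ∀ t ∈ T, Commute (b ^ j) t → t ∈ F)
    (hi : ∀ i < p, ∀ t ∈ T, Commute (a * b ^ i) t → t ∈ F) : T ≤ F := by
  induction hn : Nat.card T using Nat.strong_induction_on generalizing T with
  | _ n ih =>
  subst hn
  by_cases hT : T = ⊥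
  · rw [hT]; exact bot_le
  have hle : ⁅T, T⁆ ≤ T := commutator_le_self T
  have hcard : Nat.card (⁅T, T⁆ : Subgroup G) ∣ Nat.card T := card_dvd_of_le hle
  have hder : ⁅T, T⁆ ≤ F := by
    have hfin : Finite (⁅T, T⁆ : Subgroup G) := Finite.Set.subset (T : Set G) hle
    have hsol : Group.IsSolvable (⁅T, T⁆ : Subgroup G) :=
      Group.isSolvable_of_isSolvable_injective (inclusion_injective hle)
    have hnorm : ∀ g ∈ normalizer (T : Set G), g ∈ normalizer ((⁅T, T⁆ : Subgroup G) : Set G) := by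
      intro g hg
      rw [mem_normalizer_iff_map_conj_eq] at hg ⊢
      rw [map_commutator, hg]
    refine ih _ ?_ (hpT.coprime_dvd_right hcard) (hnorm a haT) (hnorm b hbT)
      (fun j h0 hj t ht => hb j h0 hj t (hle ht)) (fun i h t ht => hi i h t (hle ht)) rfl
    exact lt_of_le_of_ne (card_le_of_le hle) fun h =>
      (commutator_self_lt_of_isSolvable hT).ne (eq_of_le_of_card_ge hle h.ge)
  have hcomm : _root_.commutator T ≤ F.subgroupOf T := by
    rw [← map_subtype_le_map_subtype, map_subtype_commutator, subgroupOf_map_subtype]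
    exact le_inf hder hle
  have hnor : (F.subgroupOf T).Normal := .of_commutator_le _ hcomm
  have hquot := (Normal.quotient_commutative_iff_commutator_le (N := F.subgroupOf T)).2 hcomm
  let _ : CommGroup (T ⧸ F.subgroupOf T) := { mul_comm := isMulCommutative_iff.1 hquot }
  let E : Subgroup G := normalizer (T : Set G) ⊓ centralizer (F : Set G)
  have hEcomm : ∀ g : E, ∀ f ∈ F, (g : G) * f = f * g := fun g f hf =>
    ((mem_centralizer_iff.1 g.2.2) f hf).symm
  let Φ : E →* Monoid.End (T ⧸ F.subgroupOf T) :=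
    { toFun := fun g => QuotientGroup.map _ _
        ((T.normalizerMonoidHom ⟨g, g.2.1⟩ : MulAut T) : T →* T) (by
          intro f hf
          change (g : G) * f * (g : G)⁻¹ ∈ F
          rw [hEcomm g (f : G) hf, mul_inv_cancel_right]
          exact hf)
      map_one' := by
        refine MonoidHom.ext fun v => ?_
        induction v using QuotientGroup.induction_on with
        | H t =>
        refine congrArg (QuotientGroup.mk (s := F.subgroupOf T)) (Subtype.ext ?_)
        change ((1 : E) : G) * t * ((1 : E) : G)⁻¹ = t
        simp
      map_mul' := by
        intro g h
        refine MonoidHom.ext fun v => ?_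
        induction v using QuotientGroup.induction_on with
        | H t =>
        refine congrArg (QuotientGroup.mk (s := F.subgroupOf T)) (Subtype.ext ?_)
        change ((g * h : E) : G) * t * ((g * h : E) : G)⁻¹ =
          (g : G) * ((h : G) * t * (h : G)⁻¹) * (g : G)⁻¹
        simp [mul_assoc] }
  have hfix : ∀ g : E, g ^ p = 1 → (∀ t ∈ T, Commute (g : G) t → t ∈ F) →
      ∀ v, Φ g v = v → v = 1 := by
    intro g hg hgF v
    induction v using QuotientGroup.induction_on with
    | H t =>
    intro hv
    have h1 : (t : G)⁻¹ * ((g : G) * t * (g : G)⁻¹) ∈ F := 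
      (QuotientGroup.eq (s := F.subgroupOf T)).1 hv.symm
    have h2 : (g : G) * t * (g : G)⁻¹ ∈ T := (mem_normalizer_iff.1 g.2.1 t).1 t.2
    rw [QuotientGroup.eq_one_iff]
    refine hgF t t.2 (commute_of_conj_eq_mul (p := p) (by simpa using congrArg Subtype.val hg)
      (hEcomm g _ h1) (mul_inv_cancel_left _ _).symm ?_)
    refine hpT.coprime_dvd_right ?_
    exact T.orderOf_dvd_natCard (T.mul_mem (T.inv_mem t.2) h2)
  let a' : E := ⟨a, haT, mem_centralizer_iff.2 fun f hf => ((hFa f hf).eq).symm⟩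
  let b' : E := ⟨b, hbT, mem_centralizer_iff.2 fun f hf => ((hFb f hf).eq).symm⟩
  have hab' : Commute a' b' := Subtype.ext hab
  have hap' : a' ^ p = 1 := Subtype.ext hap
  have hbp' : b' ^ p = 1 := Subtype.ext hbp
  intro x hx
  have hpow : ((⟨x, hx⟩ : T) : T ⧸ F.subgroupOf T) ^ p = 1 := by
    refine Monoid.End.pow_eq_one_of_fixedPoints_trivial hp.pos (hab'.map Φ)
      (by rw [← map_pow, hap', map_one]) (by rw [← map_pow, hbp', map_one]) ?_ ?_ _
    · intro j h0 hj v
      rw [← map_pow]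
      refine hfix _ ?_ (hb j h0 hj) v
      rw [← pow_mul, mul_comm, pow_mul, hbp', one_pow]
    · intro i h v
      rw [← map_pow, ← map_mul]
      refine hfix _ ?_ (hi i h) v
      rw [(hab'.pow_right i).mul_pow, ← pow_mul, mul_comm i, pow_mul, hbp', hap', one_pow, one_mul]
  rw [← QuotientGroup.mk_pow, QuotientGroup.eq_one_iff] at hpow
  have hxp : x ^ p ∈ F := hpow
  obtain ⟨m, hm⟩ := exists_pow_eq_self_of_coprime (x := x) (n := p)
    (hpT.coprime_dvd_right (T.orderOf_dvd_natCard hx))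
  rw [← hm]
  exact pow_mem hxp m

/-! ### Invariant Sylow subgroups, removing solvability from the fixed-point criterion. -/

theorem Subgroup.relIndex_sup_of_normal_right {G : Type*} [Group G] [Finite G] (K M : Subgroup G)
    [M.Normal] : K.relIndex (K ⊔ M) = K.relIndex M := by
  have h2 := relIndex_mul_relIndex (K ⊓ M) K (K ⊔ M) inf_le_left le_sup_left
  have h3 := relIndex_mul_relIndex (K ⊓ M) M (K ⊔ M) inf_le_right le_sup_right
  rw [inf_relIndex_left] at h2
  rw [inf_relIndex_right, ← h2, relIndex_sup_right, mul_comm] at h3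
  exact (Nat.eq_of_mul_eq_mul_left (Nat.pos_of_ne_zero index_ne_zero_of_finite) h3).symm

theorem IsPGroup.exists_conj_mem_of_not_dvd_index {G : Type*} [Group G] [Finite G] {p : ℕ}
    [hp : Fact p.Prime] {E K : Subgroup G} (hE : IsPGroup p E) (hK : ¬ p ∣ K.index) :
    ∃ g : G, ∀ e ∈ E, g⁻¹ * e * g ∈ K := by
  obtain ⟨R⟩ : Nonempty (Sylow p K) := inferInstance
  have hR : ¬ p ∣ (R.map K.subtype : Subgroup G).index := by
    rw [Subgroup.index_map_subtype]
    exact fun h => (hp.out.dvd_mul.1 h).elim R.not_dvd_index hK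
  obtain ⟨P, hP⟩ := hE.exists_le_sylow
  obtain ⟨g, hg⟩ := MulAction.exists_smul_eq G ((R.2.map K.subtype).toSylow hR) P
  refine ⟨g, fun e he => ?_⟩
  have h1 := hP he
  rw [← hg, Sylow.coe_subgroup_smul, Subgroup.mem_pointwise_smul_iff_inv_smul_mem] at h1
  have h2 : g⁻¹ * e * g ∈ (R.map K.subtype : Subgroup G) := by
    simpa [← map_inv] using h1
  exact Subgroup.map_subtype_le _ h2

/-- By the Frattini argument the normalizer of a Sylow subgroup of `M` has index dividing `|M|`,
prime to `p`, so it contains a conjugate of `E`. -/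
theorem Sylow.exists_le_normalizer_of_normal {G : Type*} [Group G] [Finite G] {p q : ℕ}
    [hp : Fact p.Prime] [Fact q.Prime] {M E : Subgroup G} [M.Normal] (hM : p.Coprime (Nat.card M))
    (hE : IsPGroup p E) :
    ∃ S : Sylow q M, E ≤ Subgroup.normalizer ((S.map M.subtype : Subgroup G) : Set G) := by
  obtain ⟨S⟩ : Nonempty (Sylow q M) := inferInstance
  have hS := Sylow.normalizer_sup_eq_top S
  have hidx : ¬ p ∣ (Subgroup.normalizer ((S.map M.subtype : Subgroup G) : Set G)).index := by
    rw [← Subgroup.relIndex_top_right, ← hS, Subgroup.relIndex_sup_of_normal_right,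
      ← hp.out.coprime_iff_not_dvd]
    exact hM.coprime_dvd_right (Subgroup.relIndex_dvd_card _ _)
  obtain ⟨g, hg⟩ := hE.exists_conj_mem_of_not_dvd_index hidx
  refine ⟨(MulAut.conjNormal g : MulAut M) • S, fun e he => ?_⟩
  have hmap : (((MulAut.conjNormal g : MulAut M) • S : Sylow q M).map M.subtype : Subgroup G) =
      (S.map M.subtype).map (MulAut.conj g).toMonoidHom := by
    rw [Sylow.pointwise_smul_def, Subgroup.map_map]
    exact Subgroup.map_map _ _ _
  have h1 := Subgroup.mem_normalizer_iff_map_conj_eq.1 (hg e he)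
  rw [hmap, Subgroup.mem_normalizer_iff_map_conj_eq]
  conv_rhs => rw [← h1]
  simp only [Subgroup.map_map]
  exact congrArg (fun f => Subgroup.map f S.1) (MonoidHom.ext fun x => by simp [mul_assoc])

/-- A normal subgroup of order coprime to `p` on which a noncyclic group of order `p ^ 2`, generated
by `a` and `b`, acts by conjugation is contained in every subgroup `F` which is centralized by `a`
and `b` and contains the centralizers of the nontrivial elements of that group. -/
theorem Subgroup.le_of_forall_commute_mem_of_normal {G : Type*} [Group G] [Finite G] {p : ℕ}
    [hp : Fact p.Prime] {a b : G} (hab : Commute a b) (hap : a ^ p = 1) (hbp : b ^ p = 1)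
    {F : Subgroup G} (hFa : ∀ f ∈ F, Commute a f) (hFb : ∀ f ∈ F, Commute b f) {M : Subgroup G}
    [M.Normal] (hpM : p.Coprime (Nat.card M))
    (hb : ∀ j, 0 < j → j < p → ∀ t ∈ M, Commute (b ^ j) t → t ∈ F)
    (hi : ∀ i < p, ∀ t ∈ M, Commute (a * b ^ i) t → t ∈ F) : M ≤ F := by
  have hE : IsPGroup p (zpowers a ⊔ zpowers b : Subgroup G) := by
    have hz : ∀ x : G, x ^ p = 1 → IsPGroup p (zpowers x) := fun x hx =>
      IsPGroup.of_card_dvd_pow (n := 1) (by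
        rw [Nat.card_zpowers, pow_one]; exact orderOf_dvd_of_pow_eq_one hx)
    refine (hz a hap).to_sup_of_normal_right' (hz b hbp) ?_
    rw [zpowers_le]
    refine centralizer_le_normalizer _ ?_
    rw [mem_centralizer_iff]
    rintro _ ⟨k, rfl⟩
    exact (hab.zpow_right k).eq.symm
  -- For each prime `q`, an invariant Sylow `q`-subgroup of `M` is nilpotent, so the solvable case
  -- places it in `F`; hence `q` cannot divide the index of `F ∩ M` in `M`.
  rw [← relIndex_eq_one]
  by_contra hne
  obtain ⟨q, hq, hqd⟩ := Nat.exists_prime_and_dvd hne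
  have : Fact q.Prime := ⟨hq⟩
  obtain ⟨S, hS⟩ := Sylow.exists_le_normalizer_of_normal (q := q) hpM hE
  have hSM : (S.map M.subtype : Subgroup G) ≤ M := map_subtype_le _
  have hSq : IsPGroup q (S.map M.subtype : Subgroup G) := S.2.map _
  have hnil := hSq.isNilpotent
  have hSF : (S.map M.subtype : Subgroup G) ≤ F :=
    le_of_forall_commute_mem hp.out hab hap hbp hFa hFb
      (hpM.coprime_dvd_right (card_dvd_of_le hSM))
      (hS (mem_sup_left (mem_zpowers a))) (hS (mem_sup_right (mem_zpowers b)))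
      (fun j h0 hj t ht => hb j h0 hj t (hSM ht)) (fun i h t ht => hi i h t (hSM ht))
  refine S.not_dvd_index (hqd.trans ?_)
  exact index_dvd_of_le (map_le_iff_le_comap.1 hSF)

/-! ### T.I. subgroups. -/

theorem Subgroup.IsTI.mem_normalizer {G : Type*} [Group G] [Finite G] {H : Subgroup G}
    (hTI : H.IsTI) {x h : G} (hh : h ∈ H) (h1 : h ≠ 1) (hx : x⁻¹ * h * x ∈ H) :
    x ∈ normalizer (H : Set G) := by
  have hmem : h ∈ H ⊓ H.map (MulAut.conj x).toMonoidHom :=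
    ⟨hh, x⁻¹ * h * x, hx, by simp [mul_assoc]⟩
  rcases hTI x with h2 | h2
  · rw [mem_normalizer_iff_map_conj_eq]
    refine (eq_of_le_of_card_ge (inf_eq_left.1 h2) ?_).symm
    exact (card_map_of_injective (MulAut.conj x).injective).le
  · rw [h2, mem_bot] at hmem
    exact absurd hmem h1

theorem Subgroup.IsTI.normalizer_le {G : Type*} [Group G] [Finite G] {H : Subgroup G}
    (hTI : H.IsTI) {P : Subgroup G} (hP : P ≠ ⊥) {g : G} (hPH : ∀ e ∈ P, g⁻¹ * e * g ∈ H) {x : G}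
    (hx : x ∈ normalizer (P : Set G)) : g⁻¹ * x * g ∈ normalizer (H : Set G) := by
  obtain ⟨e, he, he1⟩ := (P.bot_or_exists_ne_one).resolve_left hP
  refine hTI.mem_normalizer (hPH e he) ?_ ?_
  · intro h
    refine he1 ?_
    simpa [mul_assoc] using congrArg (fun y => g * y * g⁻¹) h
  · have h1 : x⁻¹ * e * x ∈ P := by
      simpa using (mem_normalizer_iff.1 (inv_mem hx) e).1 he
    simpa [mul_assoc] using hPH _ h1

/-- If `p` divides both `|H|` and the index of `H`, a Sylow `p`-subgroup of `H` is properly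
contained in a larger `p`-subgroup of its normalizer. That normalizer lies in `N_G(H)`,
contradicting the Hall property there. -/
theorem Subgroup.IsTI.isHall {G : Type*} [Group G] [Finite G] {H : Subgroup G} (hTI : H.IsTI)
    (hHall : (H.subgroupOf (normalizer (H : Set G))).IsHall) : H.IsHall := by
  by_contra hcop
  obtain ⟨p, hp, hpH, hpi⟩ := Nat.Prime.not_coprime_iff_dvd.1 hcop
  have : Fact p.Prime := ⟨hp⟩
  obtain ⟨S⟩ : Nonempty (Sylow p H) := inferInstance
  set P : Subgroup G := S.map H.subtype with hPdef
  have hPH : P ≤ H := map_subtype_le _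
  have hPcard : Nat.card P = Nat.card S := card_map_of_injective H.subtype_injective
  have hPbot : P ≠ ⊥ := by
    intro h
    refine S.ne_bot_of_dvd_card hpH ?_
    rw [← card_eq_one, ← hPcard, h, card_bot]
  have hPN : normalizer (P : Set G) ≤ normalizer (H : Set G) := by
    intro x hx
    simpa using hTI.normalizer_le hPbot (g := 1) (by simpa using fun e he => hPH he) hx
  have hPrel : P.relIndex H = (S : Subgroup H).index := by
    rw [relIndex, hPdef, subgroupOf, comap_map_eq_self_of_injective H.subtype_injective]
  obtain ⟨n, hn⟩ := IsPGroup.iff_card.1 S.2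
  have hdvd : p ^ (n + 1) ∣ Nat.card G := by
    rw [← H.card_mul_index, pow_succ, ← hn]
    exact mul_dvd_mul (card_subgroup_dvd_card _) hpi
  have h1 : p ∣ P.relIndex (normalizer (P : Set G)) :=
    Sylow.prime_dvd_card_quotient_normalizer hdvd (hPcard.trans hn)
  have h2 : P.relIndex (normalizer (P : Set G)) ∣
      P.relIndex H * H.relIndex (normalizer (H : Set G)) := by
    rw [relIndex_mul_relIndex _ _ _ hPH le_normalizer,
      ← relIndex_mul_relIndex _ _ _ le_normalizer hPN]
    exact dvd_mul_right _ _
  rcases hp.dvd_mul.1 (h1.trans h2) with h3 | h3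
  · exact S.not_dvd_index (hPrel ▸ h3)
  · rw [IsHall, Nat.card_congr (subgroupOfEquivOfLe le_normalizer).toEquiv] at hHall
    exact Nat.not_coprime_of_dvd_of_dvd hp.one_lt hpH h3 hHall

theorem IsPiNumber.coprime_card {n m : ℕ} (h : IsPiNumber {p : ℕ | p.Prime ∧ p ∣ m}ᶜ n) :
    m.Coprime n := by
  by_contra hcop
  obtain ⟨p, hp, hpm, hpn⟩ := Nat.Prime.not_coprime_iff_dvd.1 hcop
  exact h p hp hpn ⟨hp, hpm⟩

/-- Take `M` maximal among normal subgroups of order prime to `|H|`. Where the series leaves `M`,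
maximality makes the factor a `π`-group, so the term `T` satisfies `T M ≤ H M`. A Sylow `p`-subgroup
of `T M` with `p` dividing `|H|` is conjugate into `H`, so the T.I. condition controls its
normalizer and the Frattini argument applies. -/
theorem Subgroup.IsTI.exists_normal_sup_normalizer_eq_top {G : Type*} [Group G] [Finite G]
    {H : Subgroup G} (hTI : H.IsTI) (hH : H.IsHall) (hne : H ≠ ⊥)
    (hsep : IsPiSeparable {p : ℕ | p.Prime ∧ p ∣ Nat.card H} G) :
    ∃ M : Subgroup G, M.Normal ∧ (Nat.card H).Coprime (Nat.card M) ∧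
      normalizer (H : Set G) ⊔ M = ⊤ := by
  obtain ⟨M, ⟨hMn, hMc⟩, hmax⟩ := Set.Finite.exists_maximal
    (s := {M : Subgroup G | M.Normal ∧ (Nat.card H).Coprime (Nat.card M)}) (Set.toFinite _)
    ⟨⊥, inferInstance, by simp⟩
  refine ⟨M, hMn, hMc, ?_⟩
  obtain ⟨n, s, hs0, hsn, hnor, hstep⟩ := hsep
  obtain ⟨j, hj, hjM, hjM'⟩ : ∃ j < n, s j ≤ M ∧ ¬ s (j + 1) ≤ M := by
    by_contra hall
    push Not at hall
    have hle : ∀ i ≤ n, s i ≤ M := by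
      intro i
      induction i with
      | zero => intro _; rw [hs0]; exact bot_le
      | succ i ih => intro hi; exact hall i hi (ih (by omega))
    have hMtop : M = ⊤ := top_le_iff.1 (hsn ▸ hle n le_rfl)
    refine hne (card_eq_one.1 ?_)
    exact Nat.eq_one_of_dvd_coprimes hMc dvd_rfl (card_dvd_of_le (hMtop ▸ le_top))
  have hTn := hnor (j + 1) hj
  set T := s (j + 1)
  have hrel : M.relIndex (T ⊔ M) ∣ (s j).relIndex T := by
    rw [relIndex_sup_right]
    exact relIndex_dvd_of_le_left T hjM
  have hcard : Nat.card M * M.relIndex (T ⊔ M) = Nat.card (T ⊔ M : Subgroup G) := by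
    rw [← relIndex_bot_left, ← relIndex_bot_left, relIndex_mul_relIndex _ _ _ bot_le le_sup_right]
  have hRM : ¬ T ⊔ M ≤ M := fun h => hjM' (le_sup_left.trans h)
  rcases (hstep j hj).2 with hpi | hpi'
  swap
  · refine absurd (hmax ⟨inferInstance, ?_⟩ le_sup_right) hRM
    rw [← hcard]
    exact hMc.mul_right ((IsPiNumber.coprime_card hpi').coprime_dvd_right hrel)
  obtain ⟨p, hp, hpd⟩ := Nat.exists_prime_and_dvd (mt relIndex_eq_one.1 hRM)
  have : Fact p.Prime := ⟨hp⟩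
  have hpH : p ∣ Nat.card H := (hpi p hp (hpd.trans hrel)).2
  -- A prime dividing the relative index would divide both `|H|` and the index of `H`.
  have hRle : T ⊔ M ≤ H ⊔ M := by
    rw [← relIndex_eq_one]
    by_contra h1
    obtain ⟨q, hq, hqd⟩ := Nat.exists_prime_and_dvd h1
    refine Nat.not_coprime_of_dvd_of_dvd hq.one_lt
      (hpi q hq ((hqd.trans (relIndex_dvd_of_le_left _ le_sup_right)).trans hrel)).2 (?_ : q ∣ _) hH
    rw [← relIndex_sup_of_normal_right] at hqd
    exact hqd.trans ((relIndex_dvd_index_of_le le_sup_left).trans (index_dvd_of_le le_sup_left))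
  obtain ⟨S⟩ : Nonempty (Sylow p (T ⊔ M : Subgroup G)) := inferInstance
  have hfrat := Sylow.normalizer_sup_eq_top S
  have hSbot : (S.map (T ⊔ M).subtype : Subgroup G) ≠ ⊥ := by
    rw [Ne, map_eq_bot_iff_of_injective _ (subtype_injective _)]
    exact S.ne_bot_of_dvd_card (hcard ▸ hpd.mul_left _)
  obtain ⟨g, hg⟩ := (IsPGroup.map S.2 (T ⊔ M).subtype).exists_conj_mem_of_not_dvd_index (K := H)
    (fun h => Nat.not_coprime_of_dvd_of_dvd hp.one_lt hpH h hH)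
  rw [eq_top_iff]
  have hHM : H ⊔ M ≤ normalizer (H : Set G) ⊔ M := sup_le_sup_right le_normalizer _
  intro z _
  have hz : g * z * g⁻¹ ∈ normalizer ((S.map (T ⊔ M).subtype : Subgroup G) : Set G) ⊔ (T ⊔ M) := by
    rw [hfrat]; exact mem_top _
  obtain ⟨x, hx, r, hr, hxr⟩ := mem_sup_of_normal_right.1 hz
  have h1 := hTI.normalizer_le hSbot hg hx
  have h2 : g⁻¹ * r * g ∈ T ⊔ M := by
    simpa using (inferInstance : (T ⊔ M).Normal).conj_mem r hr g⁻¹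
  have h3 : z = (g⁻¹ * x * g) * (g⁻¹ * r * g) := by
    have : z = g⁻¹ * (x * r) * g := by rw [hxr]; simp [mul_assoc]
    rw [this]; simp [mul_assoc]
  rw [h3]
  exact mul_mem (mem_sup_left h1) (hHM (hRle h2))

/-- The T.I. condition makes `m` normalize `H`, and then its commutators with `H` lie in `H ∩ M =
1`. -/
theorem Subgroup.IsTI.mem_centralizer {G : Type*} [Group G] [Finite G] {H M : Subgroup G}
    (hTI : H.IsTI) [hM : M.Normal] (hHM : (Nat.card H).Coprime (Nat.card M)) {h m : G} (hh : h ∈ H)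
    (h1 : h ≠ 1) (hm : m ∈ M) (hcomm : Commute h m) : m ∈ centralizer (H : Set G) := by
  have hN : m ∈ normalizer (H : Set G) := by
    refine hTI.mem_normalizer hh h1 ?_
    rw [mul_assoc, hcomm.eq, inv_mul_cancel_left]
    exact hh
  rw [mem_centralizer_iff]
  intro k hk
  have h2 : m * k * m⁻¹ * k⁻¹ ∈ H ⊓ M := by
    refine ⟨H.mul_mem ((mem_normalizer_iff.1 hN k).1 hk) (H.inv_mem hk), ?_⟩
    rw [mul_assoc, mul_assoc, ← mul_assoc k]
    exact M.mul_mem hm (hM.conj_mem _ (M.inv_mem hm) k)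
  rw [(disjoint_of_coprime_natCard hHM).eq_bot, mem_bot, mul_inv_eq_one, mul_inv_eq_iff_eq_mul] at h2
  exact h2.symm

theorem Subgroup.IsTI.isZGroup {G : Type*} [Group G] [Finite G] {H M : Subgroup G}
    (hTI : H.IsTI) (hnn : ¬ H.Normal) [M.Normal] (hHM : (Nat.card H).Coprime (Nat.card M))
    (hsup : normalizer (H : Set G) ⊔ M = ⊤) (P : Sylow 2 H) (hP : IsMulCommutative P) :
    IsZGroup H := by
  rw [isZGroup_iff]
  intro p hp S
  have : Fact p.Prime := ⟨hp⟩
  refine IsPGroup.isCyclic_of_forall_mem_zpowers S.2 ?_ ?_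
  · rw [← imp_iff_not_or]
    rintro rfl a b
    let e := S.equiv P
    exact e.injective (by rw [map_mul, map_mul]; exact mul_comm' _ _)
  intro a b ha hb hab
  by_contra hab'
  refine hnn ?_
  rw [← normalizer_eq_top_iff, eq_top_iff, ← hsup]
  refine sup_le le_rfl (le_trans ?_ (centralizer_le_normalizer _))
  let f : S →* G := H.subtype.comp S.toSubgroup.subtype
  have hf : Function.Injective f := H.subtype_injective.comp S.toSubgroup.subtype_injective
  have hfH : ∀ s, f s ∈ H := fun s => SetLike.coe_mem (s : H)
  have hpM : p.Coprime (Nat.card M) := by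
    refine hHM.coprime_dvd_left ?_
    rw [← ha, ← orderOf_coe, ← orderOf_coe]
    exact H.orderOf_dvd_natCard (hfH a)
  have hcent : ∀ s : S, s ≠ 1 → ∀ t ∈ M, Commute (f s) t → t ∈ centralizer (H : Set G) :=
    fun s hs t ht h => hTI.mem_centralizer hHM (hfH s) (by rwa [Ne, map_eq_one_iff f hf]) ht h
  refine le_of_forall_commute_mem_of_normal (p := p) (hab.map f)
    (by rw [← map_pow, orderOf_dvd_iff_pow_eq_one.1 ha.dvd, map_one])
    (by rw [← map_pow, orderOf_dvd_iff_pow_eq_one.1 hb.dvd, map_one])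
    (fun t ht => mem_centralizer_iff.1 ht _ (hfH a))
    (fun t ht => mem_centralizer_iff.1 ht _ (hfH b)) hpM ?_ ?_
  · intro j h0 hj
    rw [← map_pow]
    refine hcent _ (pow_ne_one_of_lt_orderOf h0.ne' (hj.trans_eq hb.symm))
  · intro i hi
    rw [← map_pow, ← map_mul]
    refine hcent _ fun h => hab' ?_
    rw [eq_inv_of_mul_eq_one_left h]
    exact inv_mem (pow_mem (mem_zpowers b) i)

/-! ### Coprime action on Z-groups. -/

theorem IsCyclic.mem_zpowers_of_orderOf_eq {A : Type*} [Group A] [Finite A] [IsCyclic A] {x y : A}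
    (h : orderOf x = orderOf y) : x ∈ Subgroup.zpowers y := by
  classical
  have := Fintype.ofFinite A
  have hsub : (Subgroup.zpowers y : Set A).toFinset ⊆
      Finset.univ.filter fun a : A => a ^ orderOf y = 1 := by
    intro a ha
    rw [Set.mem_toFinset, SetLike.mem_coe] at ha
    exact Finset.mem_filter.2 ⟨Finset.mem_univ _,
      orderOf_dvd_iff_pow_eq_one.1 (orderOf_dvd_of_mem_zpowers ha)⟩
  have heq := Finset.eq_of_subset_of_card_le hsub (by
    refine (IsCyclic.card_pow_eq_one_le (orderOf_pos y)).trans ?_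
    rw [Set.toFinset_card, ← Nat.card_eq_fintype_card]
    exact (Nat.card_zpowers y).ge)
  have hx : x ∈ Finset.univ.filter fun a : A => a ^ orderOf y = 1 :=
    Finset.mem_filter.2 ⟨Finset.mem_univ _, h ▸ pow_orderOf_eq_one x⟩
  rwa [← heq, Set.mem_toFinset] at hx

/-- Cyclic Sylow subgroups make all subgroups of order `p` conjugate. -/
theorem IsZGroup.mem_of_orderOf_eq_prime {H : Type*} [Group H] [Finite H] [IsZGroup H] {p : ℕ}
    [hp : Fact p.Prime] {L : Subgroup H} [hL : L.Normal] (hpL : p ∣ Nat.card L) {x : H}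
    (hx : orderOf x = p) : x ∈ L := by
  obtain ⟨y, hy⟩ := exists_prime_orderOf_dvd_card' (G := L) p hpL
  rw [← Subgroup.orderOf_coe] at hy
  have hz : ∀ z : H, orderOf z = p → IsPGroup p (Subgroup.zpowers z) := fun z hz =>
    IsPGroup.of_card (n := 1) (by rw [Nat.card_zpowers, pow_one, hz])
  obtain ⟨S, hS⟩ := (hz x hx).exists_le_sylow
  obtain ⟨g, hg⟩ := (hz y hy).exists_conj_mem_of_not_dvd_index S.not_dvd_index
  have hyL : g⁻¹ * (y : H) * g ∈ L := by simpa using hL.conj_mem y y.2 g⁻¹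
  have hord : orderOf (g⁻¹ * (y : H) * g) = p := by
    rw [← hy]
    simpa using orderOf_injective (MulAut.conj g⁻¹).toMonoidHom (MulAut.conj g⁻¹).injective (y : H)
  have hmem : (⟨x, hS (Subgroup.mem_zpowers x)⟩ : S.toSubgroup) ∈
      Subgroup.zpowers (⟨g⁻¹ * (y : H) * g, hg y (Subgroup.mem_zpowers _)⟩ : S.toSubgroup) :=
    IsCyclic.mem_zpowers_of_orderOf_eq (by rw [Subgroup.orderOf_mk, Subgroup.orderOf_mk, hx, hord])
  obtain ⟨k, hk⟩ := hmem
  have hxk : (g⁻¹ * (y : H) * g) ^ k = x := by simpa using congrArg Subtype.val hk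
  rw [← hxk]
  exact L.zpow_mem hyL k

/-- The elements `h⁻¹ * (q * h * q⁻¹)` form a cocycle of `Q` in `K`. Multiplying its values and
extracting a `|Q|`-th root in `K` exhibits it as a coboundary, and the root is the correction `k`.
-/
theorem Subgroup.exists_mul_commute_of_coprime_of_commutative {N : Type*} [Group N] [Finite N]
    {K Q : Subgroup N} [K.Normal] (hK : IsMulCommutative K)
    (hcop : (Nat.card K).Coprime (Nat.card Q)) {h : N}
    (hh : ∀ q ∈ Q, h⁻¹ * (q * h * q⁻¹) ∈ K) : ∃ k ∈ K, ∀ q ∈ Q, Commute q (h * k) := by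
  classical
  have := Fintype.ofFinite Q
  let _ : CommGroup K := { mul_comm := isMulCommutative_iff.1 hK }
  let f : Q → K := fun q => ⟨h⁻¹ * (q * h * (q : N)⁻¹), hh q q.2⟩
  let φ : N →* MulAut K := MulAut.conjNormal
  have hf : ∀ q r : Q, f (q * r) = f q * φ q (f r) := by
    intro q r
    refine Subtype.ext ?_
    change h⁻¹ * ((q * r : N) * h * (q * r : N)⁻¹) =
      h⁻¹ * (q * h * (q : N)⁻¹) * ((q : N) * (h⁻¹ * (r * h * (r : N)⁻¹)) * (q : N)⁻¹)
    simp [mul_assoc]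
  let F : K := ∏ r, f r
  have hF : ∀ q : Q, F = f q ^ Nat.card Q * φ q F := by
    intro q
    have h1 : ∏ r, f (q * r) = F := Fintype.prod_equiv (Equiv.mulLeft q) _ _ fun r => rfl
    simp only [hf, Finset.prod_mul_distrib, Finset.prod_const, ← map_prod] at h1
    rw [Nat.card_eq_fintype_card, ← Finset.card_univ]
    exact h1.symm
  obtain ⟨c, hc⟩ := (powCoprime hcop).surjective F
  rw [powCoprime_apply] at hc
  refine ⟨c, c.2, fun q hq => ?_⟩
  have h2 : c = f ⟨q, hq⟩ * φ q c := by
    refine (powCoprime hcop).injective ?_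
    rw [powCoprime_apply, powCoprime_apply, mul_pow, ← map_pow, hc]
    exact hF ⟨q, hq⟩
  have h3 : (c : N) = h⁻¹ * (q * h * q⁻¹) * (q * c * q⁻¹) := congrArg Subtype.val h2
  rw [Commute, SemiconjBy, ← mul_inv_eq_iff_eq_mul]
  conv_rhs => rw [h3]
  simp [mul_assoc]

/-- An element fixed modulo a solvable normal subgroup `K` under conjugation by a group `Q` of
order coprime to that of `K` can be modified by an element of `K` so that it centralizes `Q`. -/
theorem Subgroup.exists_mul_commute_of_coprime {N : Type*} [Group N] [Finite N]
    {K Q : Subgroup N} [hKn : K.Normal] [Group.IsSolvable K]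
    (hcop : (Nat.card K).Coprime (Nat.card Q)) {h : N}
    (hh : ∀ q ∈ Q, h⁻¹ * (q * h * q⁻¹) ∈ K) : ∃ k ∈ K, ∀ q ∈ Q, Commute q (h * k) := by
  induction hn : Nat.card K using Nat.strong_induction_on generalizing K h with
  | _ n ih =>
  subst hn
  by_cases hK : K = ⊥
  · subst hK
    refine ⟨1, one_mem _, fun q hq => ?_⟩
    have h1 := (mem_bot).1 (hh q hq)
    rw [inv_mul_eq_one, eq_mul_inv_iff_mul_eq] at h1
    rw [mul_one]
    exact h1.symm
  have hlt := commutator_self_lt_of_isSolvable hK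
  have hsol : Group.IsSolvable (⁅K, K⁆ : Subgroup N) :=
    Group.isSolvable_of_isSolvable_injective (inclusion_injective hlt.le)
  -- The abelian case corrects `h` modulo the derived subgroup; induction makes the remaining
  -- correction inside it.
  let π := QuotientGroup.mk' (⁅K, K⁆ : Subgroup N)
  have hab : IsMulCommutative (K.map π) := by
    rw [← le_centralizer_iff_isMulCommutative, ← commutator_eq_bot_iff_le_centralizer,
      ← map_commutator, map_eq_bot_iff, QuotientGroup.ker_mk']
  have hKπ : (K.map π).Normal := hKn.map π (QuotientGroup.mk'_surjective _)
  obtain ⟨_, ⟨k, hk, rfl⟩, hkQ⟩ := exists_mul_commute_of_coprime_of_commutative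
    (K := K.map π) (Q := Q.map π) hab
    ((hcop.coprime_dvd_left (card_map_dvd _ π)).coprime_dvd_right (card_map_dvd _ π)) (h := π h) (by
      rintro _ ⟨q, hq, rfl⟩
      exact ⟨_, hh q hq, by simp⟩)
  obtain ⟨k', hk', hcomm⟩ := ih (Nat.card (⁅K, K⁆ : Subgroup N))
    (lt_of_le_of_ne (card_le_of_le hlt.le) fun h => hlt.ne (eq_of_le_of_card_ge hlt.le h.ge))
    (K := ⁅K, K⁆) (h := h * k) (hcop.coprime_dvd_left (card_dvd_of_le hlt.le)) (by
      intro q hq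
      rw [← QuotientGroup.ker_mk' (⁅K, K⁆ : Subgroup N), MonoidHom.mem_ker]
      have h1 := (hkQ (π q) ⟨q, hq, rfl⟩).eq
      rw [← map_mul] at h1
      change π _ = 1
      rw [map_mul, map_mul, map_mul, h1, map_inv, map_inv, mul_inv_cancel_right, inv_mul_cancel]) rfl
  exact ⟨k * k', mul_mem hk (hlt.le hk'), fun q hq => by
    rw [← mul_assoc]; exact hcomm q hq⟩

/-- Transfer into the central subgroup `D` is the power map with exponent `D.index`; its kernel
serves as `K`. -/
theorem Subgroup.exists_characteristic_of_le_center {Z : Type*} [Group Z] [Finite Z]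
    {D : Subgroup Z} (hD : D ≤ center Z) (hcop : (Nat.card D).Coprime D.index) :
    ∃ K : Subgroup Z, K.Characteristic ∧ D ⊓ K = ⊥ ∧
      ∀ x : Z, (orderOf x).Coprime (Nat.card D) → x ∈ K := by
  have key : ∀ (g : Z) (k : ℕ) (g₀ : Z), g₀⁻¹ * g ^ k * g₀ ∈ D → g₀⁻¹ * g ^ k * g₀ = g ^ k := by
    intro g k g₀ h
    have h1 := mem_center_iff.1 (hD h) g₀
    rw [← mul_right_cancel_iff (a := g₀), ← h1]
    simp [mul_assoc]
  have hab : IsMulCommutative D := isMulCommutative_iff.2 fun a b =>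
    Subtype.ext (mem_center_iff.1 (hD b.2) a)
  let _ : CommGroup D := { mul_comm := isMulCommutative_iff.1 hab }
  let f : Z →* D := MonoidHom.transfer (MonoidHom.id D)
  have hf : ∀ g, (f g : Z) = g ^ D.index := fun g =>
    congrArg Subtype.val (MonoidHom.transfer_eq_pow (MonoidHom.id D) g (key g))
  have hker : ∀ g, g ∈ f.ker ↔ g ^ D.index = 1 := by
    intro g
    rw [MonoidHom.mem_ker, ← hf, OneMemClass.coe_eq_one]
  refine ⟨f.ker, ?_, ?_, ?_⟩
  · rw [characteristic_iff_le_comap]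
    intro ϕ g hg
    rw [mem_comap, hker, ← map_pow, (hker g).1 hg, map_one]
  · rw [eq_bot_iff]
    rintro d ⟨hd, hd'⟩
    rw [mem_bot, ← orderOf_eq_one_iff]
    exact Nat.eq_one_of_dvd_coprimes hcop (D.orderOf_dvd_natCard hd)
      (orderOf_dvd_of_pow_eq_one ((hker d).1 hd'))
  · intro x hx
    rw [hker, ← orderOf_eq_one_iff]
    refine Nat.eq_one_of_dvd_coprimes hx (orderOf_pow_dvd _) ?_
    rw [← hf]
    exact D.orderOf_dvd_natCard (f x).2

theorem Subgroup.exists_normal_inf_eq_bot_of_coprime_index {N : Type*} [Group N] [Finite N]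
    {D : Subgroup N} [D.Normal] (hab : IsMulCommutative D)
    (hcop : (Nat.card D).Coprime D.index) :
    ∃ K : Subgroup N, K.Normal ∧ D ⊓ K = ⊥ ∧
      ∀ x ∈ centralizer (D : Set N), (orderOf x).Coprime (Nat.card D) → x ∈ K := by
  have hle : D ≤ centralizer (D : Set N) := le_centralizer_iff_isMulCommutative.2 hab
  have hcard : Nat.card (D.subgroupOf (centralizer (D : Set N))) = Nat.card D :=
    Nat.card_congr (subgroupOfEquivOfLe hle).toEquiv
  obtain ⟨K, hK, hDK, hmem⟩ := exists_characteristic_of_le_center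
    (D := D.subgroupOf (centralizer (D : Set N)))
    (fun d hd => mem_center_iff.2 fun g => Subtype.ext (mem_centralizer_iff.1 g.2 d hd).symm)
    (by rw [hcard]; exact hcop.coprime_dvd_right (relIndex_dvd_index_of_le hle))
  refine ⟨K.map (centralizer (D : Set N)).subtype, inferInstance, ?_, ?_⟩
  · rw [eq_bot_iff]
    rintro _ ⟨hd, k, hk, rfl⟩
    have h1 : k ∈ D.subgroupOf (centralizer (D : Set N)) ⊓ K := ⟨hd, hk⟩
    rw [hDK, mem_bot] at h1
    rw [h1]
    exact one_mem _
  · intro x hx hxo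
    exact ⟨⟨x, hx⟩, hmem _ (by rwa [hcard, orderOf_mk]), rfl⟩

/-- The norm over `Q` maps `A` into the fixed points `D` and acts on `D` as the bijective `|Q|`-th
power, so `A` is generated by `D` and the kernel. A prime dividing both `|D|` and the index of `D`
would divide the order of the kernel, and the unique subgroup of order `p` of `A` would lie in both.
-/
theorem Subgroup.coprime_card_inf_centralizer_of_isCyclic {N : Type*} [Group N] [Finite N]
    {A Q : Subgroup N} [A.Normal] [IsCyclic A] (hcop : (Nat.card A).Coprime (Nat.card Q)) :
    (Nat.card (A ⊓ centralizer (Q : Set N) : Subgroup N)).Coprime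
      ((A ⊓ centralizer (Q : Set N)).relIndex A) := by
  classical
  have := Fintype.ofFinite Q
  let _ : CommGroup A := IsCyclic.commGroup
  set D : Subgroup A := (A ⊓ centralizer (Q : Set N)).subgroupOf A with hDdef
  have hDcard : Nat.card D = Nat.card (A ⊓ centralizer (Q : Set N) : Subgroup N) :=
    Nat.card_congr (subgroupOfEquivOfLe inf_le_left).toEquiv
  rw [← hDcard]
  change (Nat.card D).Coprime D.index
  let φ : N →* MulAut A := MulAut.conjNormal
  have hD : ∀ a : A, a ∈ D ↔ ∀ q : Q, φ q a = a := by
    intro a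
    rw [hDdef, mem_subgroupOf, mem_inf, mem_centralizer_iff]
    constructor
    · intro h q
      refine Subtype.ext ?_
      change (q : N) * a * (q : N)⁻¹ = a
      rw [h.2 q q.2, mul_inv_cancel_right]
    · intro h
      refine ⟨a.2, fun q hq => ?_⟩
      have h1 : q * a * q⁻¹ = (a : N) := congrArg Subtype.val (h ⟨q, hq⟩)
      exact mul_inv_eq_iff_eq_mul.1 h1
  let avg : A →* A := ∏ q : Q, ((φ q : MulAut A) : A →* A)
  have havg : ∀ a, avg a = ∏ q : Q, φ q a := fun a => by
    simp only [avg, MonoidHom.finsetProd_apply]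
    rfl
  have havgD : ∀ a ∈ D, avg a = a ^ Nat.card Q := by
    intro a ha
    rw [havg, Finset.prod_congr rfl fun q _ => (hD a).1 ha q, Finset.prod_const, Finset.card_univ,
      Nat.card_eq_fintype_card]
  have havgmem : ∀ a, avg a ∈ D := by
    intro a
    rw [hD]
    intro q
    rw [havg, map_prod]
    refine Fintype.prod_equiv (Equiv.mulLeft q) _ _ fun r => ?_
    change φ q (φ r a) = φ (q * r : N) a
    rw [map_mul]
    rfl
  have hsup : D ⊔ avg.ker = ⊤ := by
    rw [eq_top_iff]
    intro a _
    have hcD : (Nat.card D).Coprime (Nat.card Q) :=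
      hcop.coprime_dvd_left (card_subgroup_dvd_card D)
    obtain ⟨d, hd⟩ := (powCoprime hcD).surjective ⟨avg a, havgmem a⟩
    have hd' : (d : A) ^ Nat.card Q = avg a := congrArg Subtype.val hd
    rw [← mul_inv_cancel_left (d : A) a]
    refine mul_mem (mem_sup_left d.2) (mem_sup_right ?_)
    rw [MonoidHom.mem_ker, map_mul, map_inv, havgD d d.2, hd', inv_mul_cancel]
  by_contra hnc
  obtain ⟨p, hp, hpD, hpi⟩ := Nat.Prime.not_coprime_iff_dvd.1 hnc
  have : Fact p.Prime := ⟨hp⟩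
  obtain ⟨x, hx⟩ := exists_prime_orderOf_dvd_card' (G := D) p hpD
  have hpK : p ∣ Nat.card avg.ker := by
    rw [← relIndex_top_right, ← hsup, relIndex_sup_of_normal_right] at hpi
    exact hpi.trans (relIndex_dvd_card _ _)
  have hxK : (x : A) ∈ avg.ker :=
    IsZGroup.mem_of_orderOf_eq_prime hpK (by rwa [orderOf_coe])
  rw [MonoidHom.mem_ker, havgD x x.2] at hxK
  have hdvd := orderOf_dvd_of_pow_eq_one hxK
  rw [orderOf_coe, hx] at hdvd
  exact Nat.not_coprime_of_dvd_of_dvd hp.one_lt (hpD.trans (card_subgroup_dvd_card D)) hdvd hcop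

theorem Subgroup.normal_of_le_of_isCyclic {N : Type*} [Group N] {C D : Subgroup N} [hC : C.Normal]
    [IsCyclic C] (hDC : D ≤ C) : D.Normal := by
  refine ⟨fun d hd g => ?_⟩
  obtain ⟨m, hm⟩ := MonoidHom.map_cyclic ((MulAut.conjNormal g : MulAut C) : C →* C)
  have h1 : g * d * g⁻¹ = d ^ m := by simpa using congrArg Subtype.val (hm ⟨d, hDC hd⟩)
  rw [h1]
  exact zpow_mem hd m

/-- If `Q` acts coprimely on a normal Z-subgroup `H` and `N = H Q`, then the centralizer of `Q` in
`H` is a Hall subgroup of `N` with a normal complement. -/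
theorem Subgroup.exists_normal_complement_inf_centralizer {N : Type*} [Group N] [Finite N]
    {H Q : Subgroup N} [hHn : H.Normal] [IsZGroup H] (hcop : (Nat.card H).Coprime (Nat.card Q))
    (hsup : H ⊔ Q = ⊤) :
    (H ⊓ centralizer (Q : Set N)).IsHall ∧ ∃ L : Subgroup N, L.Normal ∧
      (H ⊓ centralizer (Q : Set N)) ⊓ L = ⊥ ∧ (H ⊓ centralizer (Q : Set N)) ⊔ L = ⊤ := by
  have hidx : H.index ∣ Nat.card Q := by
    rw [← relIndex_top_right, ← hsup, relIndex_sup_left]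
    exact relIndex_dvd_card _ _
  set C : Subgroup N := ⁅H, H⁆ with hC
  have hCH : C ≤ H := commutator_le_self H
  have hCmap : (_root_.commutator H).map H.subtype = C := map_subtype_commutator H
  have hCcard : Nat.card C = Nat.card (_root_.commutator H) := by
    rw [← hCmap, card_map_of_injective H.subtype_injective]
  have hCrel : C.relIndex H = (_root_.commutator H).index := by
    rw [relIndex, ← hCmap, subgroupOf, comap_map_eq_self_of_injective H.subtype_injective]
  have hCcyc : IsCyclic C := by
    have := IsZGroup.isCyclic_commutator H
    have e := equivMapOfInjective (_root_.commutator H) _ H.subtype_injective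
    rw [hCmap] at e
    exact isCyclic_of_surjective e e.surjective
  have hCcop : (Nat.card C).Coprime (C.relIndex H) := by
    rw [hCcard, hCrel]
    exact IsZGroup.coprime_commutator_index H
  have hcopC : (Nat.card C).Coprime (Nat.card Q) := hcop.coprime_dvd_left (card_dvd_of_le hCH)
  -- the centralizer of `Q` in the derived subgroup of `H`
  set D := C ⊓ centralizer (Q : Set N) with hD
  have hDC : D ≤ C := inf_le_left
  have hDn : D.Normal := normal_of_le_of_isCyclic hDC
  have hDcyc : IsCyclic D := isCyclic_of_injective (inclusion hDC) (inclusion_injective hDC)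
  have hDcard := card_dvd_of_le hDC
  -- `D` is Hall in `C`, `C` in `H` and `H` in `N`, so the order of `D` is prime to its index in
  -- `N`.
  obtain ⟨Z, hZn, hDZ, hZmem⟩ := exists_normal_inf_eq_bot_of_coprime_index (D := D)
    (isMulCommutative_iff.2 (IsCyclic.commGroup (α := D)).mul_comm) (by
      rw [← relIndex_mul_index hDC, ← relIndex_mul_index hCH]
      exact (coprime_card_inf_centralizer_of_isCyclic hcopC).mul_right
        ((hCcop.coprime_dvd_left hDcard).mul_right
          ((hcopC.coprime_dvd_left hDcard).coprime_dvd_right hidx)))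
  -- the centralizer of `Q` in the abelianization of `H`
  let π := QuotientGroup.mk' C
  have hπ : Function.Surjective π := QuotientGroup.mk'_surjective C
  have hA : (H.map π).Normal := hHn.map π hπ
  have hAcomm : IsMulCommutative (H.map π) := by
    rw [← le_centralizer_iff_isMulCommutative, ← commutator_eq_bot_iff_le_centralizer,
      ← map_commutator, map_eq_bot_iff, QuotientGroup.ker_mk']
  have hAcyc : IsCyclic (H.map π) := by
    have : IsZGroup (H.map π) := .of_surjective (π.subgroupMap_surjective H)
    let _ : CommGroup (H.map π) := { mul_comm := isMulCommutative_iff.1 hAcomm }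
    infer_instance
  have hcopA : (Nat.card (H.map π)).Coprime (Nat.card (Q.map π)) :=
    (hcop.coprime_dvd_left (card_map_dvd _ π)).coprime_dvd_right (card_map_dvd _ π)
  set B := H.map π ⊓ centralizer (Q.map π : Set (N ⧸ C)) with hB
  have hBA : B ≤ H.map π := inf_le_left
  have hBn : B.Normal := normal_of_le_of_isCyclic hBA
  have hBcyc : IsCyclic B := isCyclic_of_injective (inclusion hBA) (inclusion_injective hBA)
  have hBcard := (card_dvd_of_le hBA).trans (card_map_dvd H π)
  obtain ⟨W, hWn, hBW, hWmem⟩ := exists_normal_inf_eq_bot_of_coprime_index (D := B)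
    (isMulCommutative_iff.2 (IsCyclic.commGroup (α := B)).mul_comm) (by
      rw [← relIndex_mul_index hBA]
      exact (coprime_card_inf_centralizer_of_isCyclic hcopA).mul_right
        ((hcop.coprime_dvd_left hBcard).coprime_dvd_right ((index_map_dvd _ hπ).trans hidx)))
  set R := H ⊓ centralizer (Q : Set N) with hR
  -- `Q` lies in `L` because it centralizes `B` and `D` and has coprime order. An element of `R ∩ L`
  -- is trivial modulo `C` by `W`, hence lies in `D`, and is then trivial by `Z`.
  set L := W.comap π ⊓ Z with hL
  have hLn : L.Normal := inferInstance
  have hQL : Q ≤ L := by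
    intro q hq
    have hqo : orderOf q ∣ Nat.card Q := Q.orderOf_dvd_natCard hq
    refine ⟨hWmem _ ?_ ?_, hZmem _ ?_ ?_⟩
    · rw [mem_centralizer_iff]
      exact fun b hb => (mem_centralizer_iff.1 hb.2 (π q) ⟨q, hq, rfl⟩).symm
    · exact ((hcop.coprime_dvd_left hBcard).coprime_dvd_right
        ((orderOf_map_dvd π q).trans hqo)).symm
    · rw [mem_centralizer_iff]
      exact fun b hb => (mem_centralizer_iff.1 hb.2 q hq).symm
    · exact ((hcopC.coprime_dvd_left hDcard).coprime_dvd_right hqo).symm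
  have hRL : R ⊓ L = ⊥ := by
    rw [eq_bot_iff]
    rintro r ⟨⟨hrH, hrQ⟩, hrW, hrZ⟩
    have h1 : π r ∈ B ⊓ W := by
      refine ⟨⟨⟨r, hrH, rfl⟩, mem_centralizer_iff.2 ?_⟩, hrW⟩
      rintro _ ⟨q, hq, rfl⟩
      rw [← map_mul, ← map_mul, mem_centralizer_iff.1 hrQ q hq]
    rw [hBW, mem_bot, ← MonoidHom.mem_ker, QuotientGroup.ker_mk'] at h1
    rw [← hDZ]
    exact ⟨⟨h1, hrQ⟩, hrZ⟩
  have hRLsup : R ⊔ L = ⊤ := by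
    rw [eq_top_iff, ← hsup]
    refine sup_le (fun h hh => ?_) (hQL.trans le_sup_right)
    have hZG : IsZGroup (H ⊓ L : Subgroup N) := .of_injective (inclusion_injective inf_le_left)
    -- As `Q ≤ L` and `L` is normal, `Q` acts trivially on `H / (H ∩ L)`, so each coset has a
    -- representative fixed by `Q`.
    obtain ⟨k, hk, hkQ⟩ := exists_mul_commute_of_coprime (K := H ⊓ L) (Q := Q) (h := h)
      (hcop.coprime_dvd_left (card_dvd_of_le inf_le_left)) (by
        intro q hq
        refine ⟨H.mul_mem (H.inv_mem hh) (hHn.conj_mem h hh q), ?_⟩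
        rw [← mul_assoc, ← mul_assoc]
        refine L.mul_mem ?_ (L.inv_mem (hQL hq))
        simpa using hLn.conj_mem q (hQL hq) h⁻¹)
    rw [← mul_inv_cancel_right h k]
    exact mul_mem (mem_sup_left ⟨mul_mem hh hk.1, mem_centralizer_iff.2 hkQ⟩)
      (mem_sup_right (inv_mem hk.2))
  refine ⟨?_, L, hLn, hRL, hRLsup⟩
  -- A prime dividing both numbers divides `|H ∩ L|`; the Z-group property then puts an element of
  -- order `p` of `R` into `L`, against `R ∩ L = 1`.
  by_contra hnc
  obtain ⟨p, hp, hpR, hpi⟩ := Nat.Prime.not_coprime_iff_dvd.1 hnc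
  have : Fact p.Prime := ⟨hp⟩
  have hpH : p ∣ Nat.card H := hpR.trans (card_dvd_of_le inf_le_left)
  have hpL : p ∣ Nat.card L := by
    rw [← relIndex_top_right, ← hRLsup, relIndex_sup_of_normal_right] at hpi
    exact hpi.trans (relIndex_dvd_card _ _)
  have hpHL : p ∣ Nat.card (L.subgroupOf H) := by
    rw [← relIndex_bot_left, ← relIndex_mul_relIndex ⊥ (L ⊓ H) L bot_le inf_le_left] at hpL
    rcases hp.dvd_mul.1 hpL with h | h
    · rw [relIndex_bot_left, ← subgroupOf_map_subtype,
        card_map_of_injective H.subtype_injective] at h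
      exact h
    · rw [inf_relIndex_left] at h
      exact absurd hcop (Nat.not_coprime_of_dvd_of_dvd hp.one_lt hpH
        ((h.trans (relIndex_dvd_index_of_normal _ _)).trans hidx))
  obtain ⟨x, hx⟩ := exists_prime_orderOf_dvd_card' (G := R) p hpR
  rw [← orderOf_coe] at hx
  have hxL : (⟨x, x.2.1⟩ : H) ∈ L.subgroupOf H :=
    IsZGroup.mem_of_orderOf_eq_prime hpHL (by rwa [orderOf_mk])
  have hx1 : (x : N) ∈ R ⊓ L := ⟨x.2, hxL⟩
  rw [hRL, mem_bot, ← orderOf_eq_one_iff, hx] at hx1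
  exact hp.one_lt.ne' hx1

/-! ### Passage to `G / M` and back. -/

theorem theorem1p4 {G : Type*} [Group G] [Finite G] (H Q : Subgroup G)
    (hTI : H.IsTI) (hnn : ¬ H.Normal)
    (hsep : IsPiSeparable {p : ℕ | p.Prime ∧ p ∣ Nat.card H} G)
    (hHall : (H.subgroupOf (Subgroup.normalizer (H : Set G))).IsHall)
    (P : Sylow 2 H) (hP : IsMulCommutative P)
    (hQ : Q ≤ Subgroup.normalizer (H : Set G))
    (hcompl : (H.subgroupOf (Subgroup.normalizer (H : Set G))).IsComplement'
      (Q.subgroupOf (Subgroup.normalizer (H : Set G)))) :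
    (H ⊓ Subgroup.centralizer (Q : Set G)).IsHall ∧
      ∃ N : Subgroup G, N.Normal ∧
        N.IsComplement' (H ⊓ Subgroup.centralizer (Q : Set G)) := by
  have hH : H.IsHall := hTI.isHall hHall
  have hbot : H ≠ ⊥ := by
    rintro rfl
    exact hnn inferInstance
  obtain ⟨M, hM, hHM, hNM⟩ := hTI.exists_normal_sup_normalizer_eq_top hH hbot hsep
  have hZ : IsZGroup H := hTI.isZGroup hnn hHM hNM P hP
  have hHQ : H ⊔ Q = Subgroup.normalizer (H : Set G) := by
    have h1 := congrArg (Subgroup.map (Subgroup.normalizer (H : Set G)).subtype) hcompl.sup_eq_top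
    rwa [Subgroup.map_sup, Subgroup.map_subgroupOf_eq_of_le Subgroup.le_normalizer,
      Subgroup.map_subgroupOf_eq_of_le hQ, ← MonoidHom.range_eq_map, Subgroup.range_subtype] at h1
  have hcop : (Nat.card H).Coprime (Nat.card Q) := by
    have h1 := hcompl.symm.index_eq_card
    rw [Nat.card_congr (Subgroup.subgroupOfEquivOfLe hQ).toEquiv] at h1
    rw [← h1]
    rw [Subgroup.IsHall, Nat.card_congr
      (Subgroup.subgroupOfEquivOfLe Subgroup.le_normalizer).toEquiv] at hHall
    exact hHall
  let π := QuotientGroup.mk' M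
  have hπ : Function.Surjective π := QuotientGroup.mk'_surjective M
  have hker : π.ker = M := QuotientGroup.ker_mk' M
  have hHM' : H ⊓ M = ⊥ := (Subgroup.disjoint_of_coprime_natCard hHM).eq_bot
  have hNtop : (Subgroup.normalizer (H : Set G)).map π = ⊤ := by
    have h1 := congrArg (Subgroup.map π) hNM
    rwa [Subgroup.map_sup, (Subgroup.map_eq_bot_iff M).2 hker.ge, sup_bot_eq,
      Subgroup.map_top_of_surjective π hπ] at h1
  have hHn : (H.map π).Normal := by
    rw [← Subgroup.normalizer_eq_top_iff, eq_top_iff, ← hNtop]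
    exact Subgroup.le_normalizer_map π
  have hZ' : IsZGroup (H.map π) := .of_surjective (π.subgroupMap_surjective H)
  -- Fixed points lift: if `r` commutes with `q` modulo `M`, their commutator lies in `H ∩ M = 1`.
  have hR : (H ⊓ Subgroup.centralizer (Q : Set G)).map π =
      H.map π ⊓ Subgroup.centralizer (Q.map π : Set (G ⧸ M)) := by
    apply le_antisymm
    · rintro _ ⟨r, ⟨hrH, hrQ⟩, rfl⟩
      refine ⟨⟨r, hrH, rfl⟩, Subgroup.mem_centralizer_iff.2 ?_⟩
      rintro _ ⟨q, hq, rfl⟩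
      rw [← map_mul, ← map_mul, Subgroup.mem_centralizer_iff.1 hrQ q hq]
    · rintro _ ⟨⟨r, hrH, rfl⟩, hrQ⟩
      refine ⟨r, ⟨hrH, Subgroup.mem_centralizer_iff.2 fun q hq => ?_⟩, rfl⟩
      have h1 := Subgroup.mem_centralizer_iff.1 hrQ (π q) ⟨q, hq, rfl⟩
      have h2 : q * r * q⁻¹ * r⁻¹ ∈ H ⊓ M := by
        refine ⟨H.mul_mem ((Subgroup.mem_normalizer_iff.1 (hQ hq) r).1 hrH) (H.inv_mem hrH), ?_⟩
        change _ ∈ M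
        rw [← hker, MonoidHom.mem_ker, map_mul, map_mul, map_mul, h1, map_inv, map_inv,
          mul_inv_cancel_right, mul_inv_cancel]
      rwa [hHM', Subgroup.mem_bot, mul_inv_eq_one, mul_inv_eq_iff_eq_mul] at h2
  obtain ⟨hRHall, L, hL, hRL, hRLsup⟩ :=
    Subgroup.exists_normal_complement_inf_centralizer (H := H.map π) (Q := Q.map π)
      ((hcop.coprime_dvd_left (Subgroup.card_map_dvd _ π)).coprime_dvd_right
        (Subgroup.card_map_dvd _ π))
      (by rw [← Subgroup.map_sup, hHQ, hNtop])
  rw [← hR] at hRHall hRL hRLsup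
  set R := H ⊓ Subgroup.centralizer (Q : Set G) with hRdef
  have hRM : R ⊓ M = ⊥ := eq_bot_iff.2 (hHM' ▸ inf_le_inf_right M inf_le_left)
  have hcardR : Nat.card (R.map π) = Nat.card R := by
    have h1 := Subgroup.relIndex_ker π (K := R)
    rw [← h1, hker, ← Subgroup.inf_relIndex_right, inf_comm, hRM, Subgroup.relIndex_bot_left]
  constructor
  · have h1 : R.index ∣ (R.map π).index * Nat.card M := by
      have h2 := Subgroup.index_map R π
      rw [π.range_eq_top.2 hπ, Subgroup.index_top, mul_one, hker] at h2
      rw [h2, mul_comm, ← Subgroup.relIndex_mul_index (le_sup_left : R ≤ R ⊔ M),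
        Subgroup.relIndex_sup_of_normal_right]
      exact mul_dvd_mul_right (Subgroup.relIndex_dvd_card _ _) _
    refine Nat.Coprime.coprime_dvd_right h1 (Nat.Coprime.mul_right ?_ ?_)
    · rw [← hcardR]; exact hRHall
    · exact hHM.coprime_dvd_left (Subgroup.card_dvd_of_le inf_le_left)
  · refine ⟨L.comap π, hL.comap π, ?_⟩
    refine Subgroup.isComplement'_of_disjoint_and_mul_eq_univ ?_ ?_
    · rw [disjoint_iff, eq_bot_iff]
      rintro r ⟨hrL, hrR⟩
      have h1 : π r ∈ R.map π ⊓ L := ⟨⟨r, hrR, rfl⟩, hrL⟩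
      rw [hRL, Subgroup.mem_bot, ← MonoidHom.mem_ker, hker] at h1
      rw [← hRM]
      exact ⟨hrR, h1⟩
    · rw [← Subgroup.normal_mul, Set.eq_univ_iff_forall]
      intro g
      have h1 : π g ∈ R.map π ⊔ L := hRLsup ▸ Subgroup.mem_top _
      rw [← Subgroup.map_comap_eq_self_of_surjective hπ L, ← Subgroup.map_sup] at h1
      obtain ⟨y, hy, hyg⟩ := h1
      have h2 : y⁻¹ * g ∈ L.comap π := by
        rw [Subgroup.mem_comap, map_mul, map_inv, hyg, inv_mul_cancel]
        exact one_mem _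
      have h3 := mul_mem hy (Subgroup.mem_sup_right (S := R) h2)
      rw [mul_inv_cancel_left, sup_comm] at h3
      exact h3
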